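/- Let $A$ be a finite alphabet. A \emph{quotienting lattice of regular languages} is a set $\mathcal C$ of regular languages over $A$ that contains $\emptyset$ and $A^*$, is closed under (binary) union and intersection, and contains $u^{-1}K=\{w\mid uw\in K\}$ and $Ku^{-1}=\{w\mid wu\in K\}$ for all $K\in\mathcal C$ and $u\in A^*$. Its \emph{polynomial closure} $\mathrm{Pol}(\mathcal C)$ is the smallest class of languages over $A$ that contains $\mathcal C$ and is closed under union, $(H,K)\mapsto H\cup K$, and marked concatenation, $(H,K)\mapsto HaK$ for $a\in A$. For a regular language $L\subseteq A^*$, let $\equiv_L$ be the syntactic congruence on $A^*$ ($u\equiv_L v$ iff $xuy\in L\Leftrightarrow xvy\in L$ for all $x,y\in A^*$), let $\alpha_L\colon A^*\to M_L=A^*/{\equiv_L}$ be the syntactic morphism onto the (finite) syntactic monoid, and let $\leq_L$ be the syntactic order on $M_L$: $s\leq_L t$ iff $xsy\in\alpha_L(L)\Rightarrow xty\in\alpha_L(L)$ for all $x,y\in M_L$. Let $\omega\geq 1$ be the least positive integer such that $s^\omega$ is idempotent for every $s\in M_L$. A pair $(s,t)\in M_L^2$ is a \emph{$\mathcal C$-pair}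 if $\alpha_L^{-1}(s)$ is not $\mathcal C$-separable from $\alpha_L^{-1}(t)$, that is, if there is no $K\in\mathcal C$ with $\alpha_L^{-1}(s)\subseteq K$ and $K\cap\alpha_L^{-1}(t)=\emptyset$. \textbf{Theorem.} Let $\mathcal C$ be a quotienting lattice of regular languages over $A$ and let $L\subseteq A^*$ be a regular language. The following three properties are equivalent: \begin{enumerate} \item $L\in\mathrm{Pol}(\mathcal C)$; \item $s^{\omega+1}\leq_L s^\omega t s^\omega$ for every $\mathcal C$-pair $(s,t)\in M_L^2$; \item $e\leq_L ete$ for every $\mathcal C$-pair $(e,t)\in M_L^2$ with $e$ idempotent. \end{enumerate} -/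

import Mathlib

namespace PolClosure

variable {A : Type*}

/-- The right quotient `L u⁻¹ = {w | w u ∈ L}`. The left quotient `u⁻¹ L` is
`Language.leftQuotient L u`. -/
def rightQuotient (L : Language A) (u : List A) : Language A := {w | w ++ u ∈ L}

/-- A quotienting lattice of regular languages over the alphabet `A`. -/
structure IsRegularQuotientingLattice (C : Set (Language A)) : Prop where
  isRegular : ∀ K ∈ C, K.IsRegular
  empty_mem : (⊥ : Language A) ∈ C
  univ_mem : (⊤ : Language A) ∈ C
  union_mem : ∀ K ∈ C, ∀ L ∈ C, K ⊔ L ∈ C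
  inter_mem : ∀ K ∈ C, ∀ L ∈ C, K ⊓ L ∈ C
  leftQuotient_mem : ∀ L ∈ C, ∀ u : List A, L.leftQuotient u ∈ C
  rightQuotient_mem : ∀ L ∈ C, ∀ u : List A, rightQuotient L u ∈ C

/-- The polynomial closure: the smallest class that contains `C` and is closed under union and
under the marked concatenations `H a K`, `a` a letter. -/
inductive Pol (C : Set (Language A)) : Set (Language A)
  | base (L : Language A) : L ∈ C → Pol C L
  | union (H K : Language A) : Pol C H → Pol C K → Pol C (H ⊔ K)
  | marked (H K : Language A) (a : A) : Pol C H → Pol C K →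
      Pol C (H * ({[a]} : Language A) * K)

/-- `K` separates `L₁` from `L₂`. -/
def Separates (K L₁ L₂ : Language A) : Prop := L₁ ≤ K ∧ L₂ ⊓ K = ⊥

/-- `L₁` is `C`-separable from `L₂` (not a symmetric notion). -/
def Separable (C : Set (Language A)) (L₁ L₂ : Language A) : Prop :=
  ∃ K ∈ C, Separates K L₁ L₂

/-- The language `α⁻¹(s)`. -/
def fiber {M : Type*} [Monoid M] (α : FreeMonoid A →* M) (s : M) : Language A :=
  {w | α (FreeMonoid.ofList w) = s}

/-- `(s, t)` is a `C`-pair for the morphism `α`. -/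
def IsPair (C : Set (Language A)) {M : Type*} [Monoid M] (α : FreeMonoid A →* M) (s t : M) :
    Prop :=
  ¬ Separable C (fiber α s) (fiber α t)

/-- The syntactic congruence of `L`. -/
def syntacticCon (L : Language A) : Con (FreeMonoid A) where
  r u v := ∀ x y : FreeMonoid A,
    FreeMonoid.toList (x * u * y) ∈ L ↔ FreeMonoid.toList (x * v * y) ∈ L
  iseqv :=
    ⟨fun _ _ _ => Iff.rfl, fun h x y => (h x y).symm, fun h h' x y => (h x y).trans (h' x y)⟩
  mul' := by
    intro u v u' v' h h' x y
    have h₁ := h x (u' * y)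
    have h₂ := h' (x * v) y
    simp only [mul_assoc] at h₁ h₂ ⊢
    exact h₁.trans h₂

/-- The syntactic monoid `M_L`. -/
def SyntacticMonoid (L : Language A) : Type _ := (syntacticCon L).Quotient

instance (L : Language A) : Monoid (SyntacticMonoid L) :=
  inferInstanceAs (Monoid (syntacticCon L).Quotient)

/-- The syntactic morphism `α_L`, which maps a word to its class. -/
def syntacticMorphism (L : Language A) : FreeMonoid A →* SyntacticMonoid L :=
  (syntacticCon L).mk'

/-- The set `α_L(L)`. -/
def syntacticImage (L : Language A) : Set (SyntacticMonoid L) :=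
  {s | ∃ w ∈ L, syntacticMorphism L (FreeMonoid.ofList w) = s}

theorem syntacticMorphism_surjective (L : Language A) :
    Function.Surjective (syntacticMorphism L) :=
  Con.mk'_surjective

theorem syntacticMorphism_eq_iff (L : Language A) (u v : FreeMonoid A) :
    syntacticMorphism L u = syntacticMorphism L v ↔ syntacticCon L u v :=
  Con.eq _

theorem mem_syntacticImage_iff (L : Language A) (u : FreeMonoid A) :
    syntacticMorphism L u ∈ syntacticImage L ↔ FreeMonoid.toList u ∈ L := by
  constructor
  · rintro ⟨w, hw, h⟩
    have := ((syntacticMorphism_eq_iff L _ _).1 h) 1 1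
    simp only [one_mul, mul_one] at this
    exact this.1 hw
  · intro h
    exact ⟨FreeMonoid.toList u, h, rfl⟩

/-- The syntactic order `≤_L`. -/
instance (L : Language A) : PartialOrder (SyntacticMonoid L) where
  le s t := ∀ x y : SyntacticMonoid L,
    x * s * y ∈ syntacticImage L → x * t * y ∈ syntacticImage L
  le_refl _ _ _ h := h
  le_trans _ _ _ h h' x y hx := h' x y (h x y hx)
  le_antisymm s t h h' := by
    obtain ⟨u, rfl⟩ := syntacticMorphism_surjective L s
    obtain ⟨v, rfl⟩ := syntacticMorphism_surjective L t
    rw [syntacticMorphism_eq_iff]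
    intro x y
    have h₁ := h (syntacticMorphism L x) (syntacticMorphism L y)
    have h₂ := h' (syntacticMorphism L x) (syntacticMorphism L y)
    simp only [← map_mul, mem_syntacticImage_iff] at h₁ h₂
    exact ⟨h₁, h₂⟩

/-- The exponent `ω(M)`: the least positive integer `n` such that `s ^ n` is idempotent for every
`s` in `M`. It exists when `M` is finite, see `omega_spec`. -/
noncomputable def omega (M : Type*) [Monoid M] : ℕ :=
  sInf {n : ℕ | 0 < n ∧ ∀ s : M, IsIdempotentElem (s ^ n)}

theorem omega_spec (M : Type*) [Monoid M] [Finite M] :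
    0 < omega M ∧ ∀ s : M, IsIdempotentElem (s ^ omega M) := by
  have key : ∀ s : M, ∃ n : ℕ, 0 < n ∧ IsIdempotentElem (s ^ n) := by
    intro s
    obtain ⟨i, j, hij, h⟩ := Finite.exists_ne_map_eq_of_infinite (fun n : ℕ => s ^ n)
    wlog hlt : i < j generalizing i j
    · exact this j i hij.symm h.symm (by omega)
    obtain ⟨p, rfl⟩ : ∃ p, j = i + p := ⟨j - i, by omega⟩
    have hp : 0 < p := by omega
    have step : ∀ q k : ℕ, s ^ (i + k + q * p) = s ^ (i + k) := by
      intro q k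
      induction q with
      | zero => simp
      | succ q ih =>
        have : i + k + (q + 1) * p = (i + p) + (k + q * p) := by ring
        rw [this, pow_add]
        have h' : s ^ (i + p) = s ^ i := h.symm
        rw [h', ← pow_add, ← ih]
        congr 1
        ring
    refine ⟨(i + 1) * p, by positivity, ?_⟩
    have hle : i ≤ (i + 1) * p := by nlinarith
    obtain ⟨k, hk⟩ := Nat.exists_eq_add_of_le hle
    have := step (i + 1) k
    rw [← hk] at this
    rw [IsIdempotentElem, ← pow_add, this]
  choose f hf hf' using key
  have := Fintype.ofFinite M
  refine Nat.sInf_mem (s := {n : ℕ | 0 < n ∧ ∀ s : M, IsIdempotentElem (s ^ n)})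
    ⟨∏ s, f s, Finset.prod_pos fun s _ => hf s, fun s => ?_⟩
  obtain ⟨c, hc⟩ := Finset.dvd_prod_of_mem f (Finset.mem_univ s)
  rw [hc, pow_mul]
  exact (hf' s).pow c

/-- The syntactic monoid of a regular language is finite. -/
theorem finite_syntacticMonoid {L : Language A} (hL : L.IsRegular) :
    Finite (SyntacticMonoid L) := by
  obtain ⟨σ, _, D, rfl⟩ := hL
  choose g hg using syntacticMorphism_surjective D.accepts
  refine Finite.of_injective
    (fun s => fun q : σ => D.evalFrom q (FreeMonoid.toList (g s))) ?_
  intro s t h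
  rw [← hg s, ← hg t, syntacticMorphism_eq_iff]
  intro x y
  simp only [FreeMonoid.toList_mul, DFA.mem_accepts, DFA.eval, DFA.evalFrom_of_append]
  have := congrFun h (D.evalFrom D.start (FreeMonoid.toList x))
  simp only at this
  rw [this]

end PolClosure

/-!
For `3 → 1`, consider the words `w` whose image lies at least as high in the `𝒥`-order of `M` as a
given level: they are products of blocks obtained from strictly higher words by adding one letter.
Colour a cut `l | r` of such a product, read in the context `(p, q)`, by `(p * α l, α r * q)`. By
stability of finite monoids, all factors between two cuts of the same colour have the same
idempotent image. Eliminating one colour after the other, one builds all words from the letters by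
a bounded number of unions, products and Ramsey nodes `U_e * α⁻¹(e) * U_e`. At a Ramsey node, the
middle factor is covered by one language `H ∈ C` that contains `α⁻¹(e)` and satisfies
`e ≤ e * α v * e` for all `v ∈ H`: intersect the languages separating `α⁻¹(e)` from the `α⁻¹(t)`
such that `e ≤ e * t * e` fails.

For `1 → 2`, one copy of `u` in a large power may be replaced by any word `v` that belongs to all
languages of a suitable finite `D ⊆ C` containing `u`: when a word of `H * {[c]} * K` is pumped, one
side of the marked letter contains a large power of `u`. A `C`-pair provides such words `u` and `v`
for every finite `D ⊆ C`.
-/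

namespace PolClosure

open Pointwise

section Ideals

variable {M : Type*} [Monoid M]

/-- The number of elements of the two-sided ideal `MsM`. It measures the position of `s` in the
`𝒥`-order of a finite monoid by a natural number. -/
noncomputable def idealCard (s : M) : ℕ := {z : M | ∃ x y, z = x * s * y}.ncard

theorem pow_mul_mul_pow_eq {f x b : M} (h : f * x * b = x) (n : ℕ) : f ^ n * x * b ^ n = x := by
  induction n with
  | zero => simp
  | succ n ih =>
    calc f ^ (n + 1) * x * b ^ (n + 1) = f ^ n * (f * x * b) * b ^ n := by
          rw [pow_succ f, pow_succ' b]; simp only [mul_assoc]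
      _ = x := by rw [h, ih]

variable [Finite M]

theorem pow_omega_mul_eq_pow_omega (s : M) {n : ℕ} (hn : n ≠ 0) :
    s ^ (omega M * n) = s ^ omega M := by
  rw [pow_mul]
  exact ((omega_spec M).2 s).pow_eq hn

theorem pow_eq_pow_of_modEq_omega (s : M) {i j : ℕ}
    (hi : omega M ≤ i) (hj : omega M ≤ j) (hij : i ≡ j [MOD omega M]) : s ^ i = s ^ j := by
  wlog hle : i ≤ j generalizing i j
  · exact (this hj hi hij.symm (le_of_not_ge hle)).symm
  obtain ⟨k, hk⟩ := (Nat.modEq_iff_dvd' hle).1 hij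
  obtain ⟨d, rfl⟩ := Nat.exists_eq_add_of_le hi
  have hj : j = omega M * (k + 1) + d := by rw [mul_add]; omega
  rw [hj, pow_add, pow_add, pow_omega_mul_eq_pow_omega s k.succ_ne_zero]

theorem pow_omega_mul_of_mul_mul_eq {f x b : M} (h : f * x * b = x) : f ^ omega M * x = x := by
  rw [← pow_mul_mul_pow_eq h (omega M), ← mul_assoc, ← mul_assoc, ((omega_spec M).2 f).eq]

theorem mul_pow_omega_of_mul_mul_eq {f x b : M} (h : f * x * b = x) : x * b ^ omega M = x := by
  rw [← pow_mul_mul_pow_eq h (omega M), mul_assoc, ((omega_spec M).2 b).eq]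

theorem idealCard_le_card (s : M) : idealCard s ≤ Nat.card M :=
  Set.ncard_le_card _

theorem idealCard_mul_mul_le (x s y : M) : idealCard (x * s * y) ≤ idealCard s := by
  refine Set.ncard_le_ncard ?_ (Set.toFinite _)
  rintro _ ⟨a, b, rfl⟩
  exact ⟨a * x, y * b, by simp only [mul_assoc]⟩

theorem idealCard_mul_le_left (s t : M) : idealCard (s * t) ≤ idealCard s := by
  simpa using idealCard_mul_mul_le 1 s t

theorem idealCard_mul_le_right (s t : M) : idealCard (s * t) ≤ idealCard t := by
  simpa using idealCard_mul_mul_le s t 1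

theorem exists_mul_mul_eq_of_idealCard_le {a x b : M} (h : idealCard x ≤ idealCard (a * x * b)) :
    ∃ c d, c * (a * x * b) * d = x := by
  have hsub : {z : M | ∃ c d, z = c * (a * x * b) * d} ⊆ {z : M | ∃ c d, z = c * x * d} := by
    rintro _ ⟨c, d, rfl⟩
    exact ⟨c * a, b * d, by simp only [mul_assoc]⟩
  have hx : x ∈ {z : M | ∃ c d, z = c * x * d} := ⟨1, 1, by simp⟩
  rw [← Set.eq_of_subset_of_ncard_le hsub h (Set.toFinite _)] at hx
  obtain ⟨c, d, hcd⟩ := hx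
  exact ⟨c, d, hcd.symm⟩

-- Stability of finite monoids: `x = (a * z) * x * b` forces `x = (a * z) ^ ω * x`.
theorem exists_mul_mul_left_eq_of_idealCard_le {z x : M} (h : idealCard x ≤ idealCard (z * x)) :
    ∃ y, y * (z * x) = x := by
  obtain ⟨a, b, hab⟩ := exists_mul_mul_eq_of_idealCard_le (a := z) (x := x) (b := 1) (by simpa)
  have hfix : (a * z) ^ omega M * x = x :=
    pow_omega_mul_of_mul_mul_eq (b := b) (by simpa only [mul_one, mul_assoc] using hab)
  refine ⟨(a * z) ^ (omega M - 1) * a, ?_⟩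
  rw [← Nat.sub_add_cancel (omega_spec M).1, pow_succ] at hfix
  simpa only [mul_assoc] using hfix

theorem exists_mul_mul_right_eq_of_idealCard_le {z x : M} (h : idealCard x ≤ idealCard (x * z)) :
    ∃ y, x * z * y = x := by
  obtain ⟨a, b, hab⟩ := exists_mul_mul_eq_of_idealCard_le (a := 1) (x := x) (b := z) (by simpa)
  have hfix : x * (z * b) ^ omega M = x :=
    mul_pow_omega_of_mul_mul_eq (f := a) (by simpa only [one_mul, mul_assoc] using hab)
  refine ⟨b * (z * b) ^ (omega M - 1), ?_⟩
  rw [← Nat.sub_add_cancel (omega_spec M).1, pow_succ'] at hfix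
  simpa only [mul_assoc] using hfix

theorem mul_eq_left_of_fix {p x y : M} (hx : p * x = p) (hy : p * y = p)
    (hcard : idealCard x ≤ idealCard p) : x * y = x := by
  obtain ⟨a, ha⟩ := exists_mul_mul_left_eq_of_idealCard_le (z := p) (x := x) (by rwa [hx])
  rw [hx] at ha
  rw [← ha, mul_assoc, hy]

theorem mul_eq_right_of_fix {q x y : M} (hx : x * q = q) (hy : y * q = q)
    (hcard : idealCard y ≤ idealCard q) : x * y = y := by
  obtain ⟨a, ha⟩ := exists_mul_mul_right_eq_of_idealCard_le (x := y) (z := q) (by rwa [hy])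
  rw [hy] at ha
  rw [← ha, ← mul_assoc, hx]

end Ideals

section FactorizationForest

variable {N M : Type*} [Monoid N] [Monoid M]

/-- `BoundedForest α S U` says that the words of `U` have factorization forests of bounded height
over the generators in `S`: `U` is obtained from `S` and `{1}` by finitely many unions, products,
restrictions and Ramsey nodes. At a Ramsey node, where all the factors have the same idempotent
image `e`, the factors other than the first and the last are merged into an arbitrary word with
image `e`. -/
inductive BoundedForest (α : N →* M) (S : Set N) : Set N → Prop
  | generators : BoundedForest α S S
  | one : BoundedForest α S {1}
  | subset {U V : Set N} : U ⊆ V → BoundedForest α S V → BoundedForest α S U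
  | union {U V : Set N} :
      BoundedForest α S U → BoundedForest α S V → BoundedForest α S (U ∪ V)
  | mul {U V : Set N} :
      BoundedForest α S U → BoundedForest α S V → BoundedForest α S (U * V)
  | ramsey {U : Set N} {e : M} : IsIdempotentElem e → BoundedForest α S U →
      BoundedForest α S ((U ∩ α ⁻¹' {e}) * α ⁻¹' {e} * (U ∩ α ⁻¹' {e}))

theorem BoundedForest.iUnion {α : N →* M} {S : Set N} {ι : Type*} [Finite ι] {U : ι → Set N}
    (hU : ∀ i, BoundedForest α S (U i)) : BoundedForest α S (⋃ i, U i) :=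
  SupClosed.iSup_mem (s := {V | BoundedForest α S V}) (fun _ hV _ hW => hV.union hW)
    (.subset (Set.empty_subset _) .one) hU

/-- Read in the context `(p, q)`, a factorization `bs = l ++ r` into nonempty parts is a cut of
colour `(p * α l.prod, α r.prod * q)`; `CutsIn α T p q bs` says that all the cuts of `bs` have
colours in `T`. -/
def CutsIn (α : N →* M) (T : Set (M × M)) : M → M → List N → Prop
  | _, _, [] => True
  | p, q, b :: bs =>
      (bs ≠ [] → (p * α b, α bs.prod * q) ∈ T) ∧ CutsIn α T (p * α b) q bs

variable {α : N →* M} {T : Set (M × M)} {p q p' q' : M} {bs : List N}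

theorem CutsIn.append_left {l r : List N} (h : CutsIn α T p q (l ++ r)) :
    CutsIn α T p (α r.prod * q) l := by
  induction l generalizing p with
  | nil => trivial
  | cons b l ih =>
    refine ⟨fun hl => ?_, ih h.2⟩
    simpa [mul_assoc] using h.1 (by simp [hl])

theorem CutsIn.append_right {l r : List N} (h : CutsIn α T p q (l ++ r)) :
    CutsIn α T (p * α l.prod) q r := by
  induction l generalizing p with
  | nil => simpa using h
  | cons b l ih => simpa [mul_assoc] using ih h.2

theorem CutsIn.exists_first_cut (h : CutsIn α (insert (p', q') T) p q bs) :
    CutsIn α T p q bs ∨ ∃ l r, bs = l ++ r ∧ (l ≠ [] ∧ r ≠ []) ∧ p * α l.prod = p' ∧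
      α r.prod * q = q' ∧ CutsIn α T p q' l := by
  induction bs generalizing p with
  | nil => exact Or.inl trivial
  | cons b bs ih =>
    obtain rfl | hbs := eq_or_ne bs []
    · exact Or.inl ⟨fun h => absurd rfl h, trivial⟩
    rcases h.1 hbs with hc | hT
    · obtain ⟨hp, hq⟩ := Prod.mk.inj hc
      exact Or.inr ⟨[b], bs, rfl, ⟨by simp, hbs⟩, by simpa using hp, hq,
        fun h => absurd rfl h, trivial⟩
    · rcases ih h.2 with hno | ⟨l, r, rfl, ⟨-, hr⟩, hp, rfl, hl⟩
      · exact Or.inl ⟨fun _ => hT, hno⟩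
      · refine Or.inr ⟨b :: l, r, rfl, ⟨by simp, hr⟩, by simpa [mul_assoc] using hp, rfl,
          fun _ => ?_, hl⟩
        simpa [mul_assoc] using hT

theorem CutsIn.exists_last_cut (h : CutsIn α (insert (p', q') T) p q bs) :
    CutsIn α T p q bs ∨ ∃ l r, bs = l ++ r ∧ (l ≠ [] ∧ r ≠ []) ∧ p * α l.prod = p' ∧
      α r.prod * q = q' ∧ CutsIn α T p' q r := by
  induction bs generalizing p with
  | nil => exact Or.inl trivial
  | cons b bs ih =>
    rcases ih h.2 with hno | ⟨l, r, rfl, ⟨-, hr⟩, hp, hq, hrT⟩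
    · obtain rfl | hbs := eq_or_ne bs []
      · exact Or.inl ⟨fun h => absurd rfl h, trivial⟩
      rcases h.1 hbs with hc | hT
      · obtain ⟨rfl, hq⟩ := Prod.mk.inj hc
        exact Or.inr ⟨[b], bs, rfl, ⟨by simp, hbs⟩, by simp, hq, hno⟩
      · exact Or.inl ⟨fun _ => hT, hno⟩
    · exact Or.inr ⟨b :: l, r, rfl, ⟨by simp, hr⟩, by simpa [mul_assoc] using hp, hq, hrT⟩

theorem CutsIn.exists_first_last_cut (h : CutsIn α (insert (p', q') T) p q bs) :
    CutsIn α T p q bs ∨ ∃ l m r, bs = l ++ (m ++ r) ∧ (l ≠ [] ∧ r ≠ []) ∧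
      (p * α l.prod = p' ∧ p' * α m.prod = p') ∧ (α m.prod * q' = q' ∧ α r.prod * q = q') ∧
      CutsIn α T p q' l ∧ CutsIn α (insert (p', q') T) p' q' m ∧ CutsIn α T p' q r := by
  rcases h.exists_first_cut with hno | ⟨l, s, rfl, ⟨hl, hs⟩, rfl, rfl, hlT⟩
  · exact Or.inl hno
  right
  have hsT := h.append_right
  rcases hsT.exists_last_cut with hno | ⟨m, r, rfl, ⟨-, hr⟩, hp, hq, hrT⟩
  · exact ⟨l, [], s, rfl, ⟨hl, hs⟩, ⟨rfl, by simp⟩, ⟨by simp, rfl⟩, hlT, trivial, hno⟩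
  · have hmT := hsT.append_left
    rw [hq] at hmT
    refine ⟨l, m, r, rfl, ⟨hl, hr⟩, ⟨rfl, hp⟩, ⟨?_, hq⟩, hlT, hmT, hrT⟩
    calc α m.prod * (α (m ++ r).prod * q) = α m.prod * (α r.prod * q) := by rw [hq]
      _ = α (m ++ r).prod * q := by simp [mul_assoc]

theorem cutsIn_of_idealCard_le [Finite M] {k : ℕ} (h : k ≤ idealCard (p * α bs.prod * q)) :
    CutsIn α {c | k ≤ idealCard c.1 ∧ k ≤ idealCard c.2} p q bs := by
  induction bs generalizing p with
  | nil => trivial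
  | cons b bs ih =>
    have hcut : k ≤ idealCard (p * α b * (α bs.prod * q)) := by simpa [mul_assoc] using h
    exact ⟨fun _ => ⟨hcut.trans (idealCard_mul_le_left _ _),
      hcut.trans (idealCard_mul_le_right _ _)⟩, ih (by simpa [mul_assoc] using hcut)⟩

variable (α) in
/-- The products of blocks taken in `W` whose cuts, read in the context `(p, q)`, have colours
in `T`. -/
def blockProducts (W : Set N) (T : Set (M × M)) (p q : M) : Set N :=
  {w | ∃ bs : List N, (∀ b ∈ bs, b ∈ W) ∧ CutsIn α T p q bs ∧ bs.prod = w}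

variable {W : Set N}

theorem blockProducts_empty_subset : blockProducts α W ∅ p q ⊆ {1} ∪ W := by
  rintro _ ⟨bs, hW, hT, rfl⟩
  match bs with
  | [] => simp
  | [b] => simpa using Or.inr (hW b (by simp))
  | _ :: _ :: _ => exact absurd (hT.1 (by simp)) (Set.notMem_empty _)

theorem blockProducts_insert_subset :
    blockProducts α W (insert (p', q') T) p q ⊆ blockProducts α W T p q ∪
      blockProducts α W T p q' *
        ({m ∈ blockProducts α W (insert (p', q') T) p' q' | p' * α m = p' ∧ α m * q' = q'} *
          blockProducts α W T p' q) := by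
  rintro _ ⟨bs, hW, hT, rfl⟩
  rcases hT.exists_first_last_cut with hno | ⟨l, m, r, rfl, -, hp, hq, hl, hm, hr⟩
  · exact Or.inl ⟨bs, hW, hno, rfl⟩
  · simp only [List.forall_mem_append] at hW
    rw [List.prod_append, List.prod_append]
    exact Or.inr (Set.mul_mem_mul ⟨l, hW.1, hl, rfl⟩
      (Set.mul_mem_mul ⟨⟨m, hW.2.1, hm, rfl⟩, hp.2, hq.1⟩ ⟨r, hW.2.2, hr, rfl⟩))

variable [Finite M] {k : ℕ}

theorem idealCard_prod_le (hbs : bs ≠ []) (h : ∀ b ∈ bs, idealCard (α b) ≤ k) :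
    idealCard (α bs.prod) ≤ k := by
  obtain ⟨b, bs, rfl⟩ := List.exists_cons_of_ne_nil hbs
  rw [List.prod_cons, map_mul]
  exact (idealCard_mul_le_left _ _).trans (h b (by simp))


theorem blockProducts_insert_inter_fixed_subset (hW : ∀ b ∈ W, idealCard (α b) ≤ k)
    (hp : k ≤ idealCard p) (hq : k ≤ idealCard q) :
    {w ∈ blockProducts α W (insert (p, q) T) p q | p * α w = p ∧ α w * q = q} ⊆
      blockProducts α W T p q ∪ blockProducts α W T p q * blockProducts α W T p q ∪
      ⋃ e : {e : M // IsIdempotentElem e}, (blockProducts α W T p q ∩ α ⁻¹' {e.1}) *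
        α ⁻¹' {e.1} * (blockProducts α W T p q ∩ α ⁻¹' {e.1}) := by
  rintro _ ⟨⟨bs, hbs, hT, rfl⟩, hpw, hqw⟩
  rcases hT.exists_first_last_cut with
    hno | ⟨l, m, r, rfl, ⟨hl0, hr0⟩, ⟨hpl, hpm⟩, ⟨hqm, hqr⟩, hl, -, hr⟩
  · exact Or.inl (Or.inl ⟨bs, hbs, hno, rfl⟩)
  simp only [List.forall_mem_append] at hbs
  obtain ⟨hlW, hmW, hrW⟩ := hbs
  simp only [List.prod_append, map_mul, mul_assoc] at hpw hqw
  rw [List.prod_append, List.prod_append]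
  have hlZ : l.prod ∈ blockProducts α W T p q := ⟨l, hlW, hl, rfl⟩
  have hrZ : r.prod ∈ blockProducts α W T p q := ⟨r, hrW, hr, rfl⟩
  obtain rfl | hm0 := eq_or_ne m []
  · rw [List.prod_nil, one_mul]
    exact Or.inl (Or.inr (Set.mul_mem_mul hlZ hrZ))
  right
  have hql : α l.prod * q = q := by rwa [hqr, hqm] at hqw
  have hpr : p * α r.prod = p := by rwa [← mul_assoc, hpl, ← mul_assoc, hpm] at hpw
  have card_le {cs : List N} (hcs : cs ≠ []) (hcsW : ∀ b ∈ cs, b ∈ W) :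
      idealCard (α cs.prod) ≤ k := idealCard_prod_le hcs fun b hb => hW b (hcsW b hb)
  have hm := card_le hm0 hmW
  have hlm : α l.prod = α m.prod :=
    (mul_eq_left_of_fix hpl hpm ((card_le hl0 hlW).trans hp)).symm.trans
      (mul_eq_right_of_fix hql hqm (hm.trans hq))
  have hrm : α r.prod = α m.prod :=
    (mul_eq_right_of_fix hqm hqr ((card_le hr0 hrW).trans hq)).symm.trans
      (mul_eq_left_of_fix hpm hpr (hm.trans hp))
  have hidem : IsIdempotentElem (α m.prod) := mul_eq_left_of_fix hpm hpm (hm.trans hp)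
  rw [← mul_assoc]
  exact Set.mem_iUnion.2 ⟨⟨_, hidem⟩,
    Set.mul_mem_mul (Set.mul_mem_mul ⟨hlZ, hlm⟩ rfl) ⟨hrZ, hrm⟩⟩

variable {S : Set N}

theorem BoundedForest.blockProducts (hBF : BoundedForest α S W)
    (hW : ∀ b ∈ W, idealCard (α b) ≤ k)
    (hT : ∀ c ∈ T, k ≤ idealCard c.1 ∧ k ≤ idealCard c.2) (p q : M) :
    BoundedForest α S (blockProducts α W T p q) := by
  induction T, T.toFinite using Set.Finite.induction_on generalizing p q with
  | empty => exact (one.union hBF).subset blockProducts_empty_subset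
  | @insert c T _ _ ih =>
    have hZ := ih fun c hc => hT c (Set.mem_insert_of_mem _ hc)
    obtain ⟨hc₁, hc₂⟩ := hT c (Set.mem_insert _ _)
    have hmid := ((hZ c.1 c.2).union ((hZ c.1 c.2).mul (hZ c.1 c.2))).union
      (.iUnion fun e : {e : M // IsIdempotentElem e} => (hZ c.1 c.2).ramsey e.2)
    exact ((hZ p q).union ((hZ p c.2).mul ((hmid.subset
      (blockProducts_insert_inter_fixed_subset hW hc₁ hc₂)).mul (hZ c.1 q)))).subset
        blockProducts_insert_subset

theorem exists_block_factorization (hS : Submonoid.closure S = ⊤) (w : N)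
    (hw : k ≤ idealCard (α w)) :
    ∃ u ∈ {1} ∪ {u | k < idealCard (α u)}, ∃ bs : List N, u * bs.prod = w ∧
      ∀ b ∈ bs, b ∈ S * ({1} ∪ {u | k < idealCard (α u)}) ∩ {b | idealCard (α b) ≤ k} := by
  induction w using Submonoid.induction_of_closure_eq_top_left hS with
  | one => exact ⟨1, by simp, [], by simp⟩
  | mul_left a ha w ih =>
    rw [map_mul] at hw
    obtain ⟨u, hu, bs, rfl, hbs⟩ := ih (hw.trans (idealCard_mul_le_right _ _))
    rcases lt_or_ge k (idealCard (α (a * u))) with hlt | hle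
    · exact ⟨a * u, Or.inr hlt, bs, mul_assoc _ _ _, hbs⟩
    · refine ⟨1, by simp, (a * u) :: bs, by simp [mul_assoc], ?_⟩
      simpa only [List.forall_mem_cons] using ⟨⟨Set.mul_mem_mul ha hu, hle⟩, hbs⟩

theorem BoundedForest.le_idealCard (hS : Submonoid.closure S = ⊤)
    (h : BoundedForest α S {u | k < idealCard (α u)}) :
    BoundedForest α S {u | k ≤ idealCard (α u)} := by
  have hu := one.union h
  have hW := (generators.mul hu).subset
    (Set.inter_subset_left (t := {b | idealCard (α b) ≤ k}))
  refine (hu.mul (hW.blockProducts (fun b hb => hb.2) (fun c hc => hc)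
    (T := {c | k ≤ idealCard c.1 ∧ k ≤ idealCard c.2}) 1 1)).subset fun w hw => ?_
  obtain ⟨u, hu, bs, rfl, hbs⟩ := exists_block_factorization hS w hw
  rw [Set.mem_ofPred_eq, map_mul] at hw
  refine Set.mul_mem_mul hu ⟨bs, hbs, cutsIn_of_idealCard_le ?_, rfl⟩
  simpa using hw.trans (idealCard_mul_le_right _ _)

theorem BoundedForest.univ (hS : Submonoid.closure S = ⊤) : BoundedForest α S Set.univ := by
  have htop : BoundedForest α S {u | Nat.card M + 1 ≤ idealCard (α u)} :=
    one.subset fun u hu => absurd (idealCard_le_card (α u)) (by simpa using hu)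
  have hzero : BoundedForest α S {u | 0 ≤ idealCard (α u)} :=
    Nat.decreasingInduction' (fun _ _ _ h => le_idealCard hS h) (Nat.zero_le _) htop
  simpa using hzero

end FactorizationForest

section PolynomialClosure

variable {A : Type*} {C : Set (Language A)} {H K : Language A}

theorem Pol.supClosed : SupClosed (Pol C) :=
  fun _ hH _ hK => Pol.union _ _ hH hK

theorem IsRegularQuotientingLattice.supClosed (hC : IsRegularQuotientingLattice C) :
    SupClosed C :=
  fun _ hH _ hK => hC.union_mem _ hH _ hK

theorem IsRegularQuotientingLattice.infClosed (hC : IsRegularQuotientingLattice C) :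
    InfClosed C :=
  fun _ hH _ hK => hC.inter_mem _ hH _ hK

theorem Pol.iSup_mem (hC : IsRegularQuotientingLattice C) {ι : Type*} [Finite ι]
    {K : ι → Language A} (hK : ∀ i, K i ∈ Pol C) : ⨆ i, K i ∈ Pol C :=
  Pol.supClosed.iSup_mem (Pol.base _ hC.empty_mem) hK

theorem mem_marked_iff {a : A} {w : FreeMonoid A} :
    w.toList ∈ H * {[a]} * K ↔ ∃ u v : FreeMonoid A,
      w = u * FreeMonoid.of a * v ∧ u.toList ∈ H ∧ v.toList ∈ K := by
  constructor
  · rintro ⟨_, ⟨u, hu, _, rfl, rfl⟩, v, hv, rfl⟩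
    exact ⟨.ofList u, .ofList v, rfl, hu, hv⟩
  · rintro ⟨u, v, rfl, hu, hv⟩
    exact ⟨_, ⟨_, hu, _, rfl, rfl⟩, _, hv, rfl⟩

open Classical in
theorem mul_eq_sup_iSup_marked (H K : Language A) :
    H * K = (if [] ∈ H then K else ⊥) ⊔ ⨆ a, rightQuotient H [a] * {[a]} * K := by
  have hH : H = (if [] ∈ H then 1 else 0) + ⨆ a, rightQuotient H [a] * {[a]} := by
    ext w
    rw [Language.mem_add, Language.mem_iSup]
    constructor
    · intro hw
      rcases w.eq_nil_or_concat' with rfl | ⟨u, a, rfl⟩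
      · exact Or.inl (by simp [hw])
      · exact Or.inr ⟨a, Language.append_mem_mul hw rfl⟩
    · rintro (hw | ⟨a, u, hu, _, rfl, rfl⟩)
      · split_ifs at hw with h
        · rwa [(Language.mem_one w).1 hw]
        · exact absurd hw (Language.notMem_zero w)
      · exact hu
  conv_lhs => rw [hH]
  rw [add_mul, Language.iSup_mul, ite_mul, one_mul, zero_mul]
  rfl

theorem Pol.mul_of_mem [Finite A] (hC : IsRegularQuotientingLattice C) (hH : H ∈ C)
    (hK : K ∈ C) : H * K ∈ Pol C := by
  rw [mul_eq_sup_iSup_marked]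
  refine Pol.union _ _ ?_ (Pol.iSup_mem hC fun a =>
    Pol.marked _ _ a (Pol.base _ (hC.rightQuotient_mem H hH [a])) (Pol.base K hK))
  split_ifs
  · exact Pol.base K hK
  · exact Pol.base ⊥ hC.empty_mem

theorem Pol.mul [Finite A] (hC : IsRegularQuotientingLattice C) (hH : H ∈ Pol C)
    (hK : K ∈ Pol C) : H * K ∈ Pol C := by
  induction hH with
  | base H hH =>
    induction hK with
    | base K hK => exact Pol.mul_of_mem hC hH hK
    | union K₁ K₂ _ _ ih₁ ih₂ =>
      rw [show H * (K₁ ⊔ K₂) = H * K₁ ⊔ H * K₂ from mul_add H K₁ K₂]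
      exact Pol.union _ _ ih₁ ih₂
    | marked K₁ K₂ a _ hK₂ ih₁ _ =>
      rw [← mul_assoc, ← mul_assoc]
      exact Pol.marked _ _ a ih₁ hK₂
  | union H₁ H₂ _ _ ih₁ ih₂ =>
    rw [show (H₁ ⊔ H₂) * K = H₁ * K ⊔ H₂ * K from add_mul H₁ H₂ K]
    exact Pol.union _ _ ih₁ ih₂
  | marked H₁ H₂ a hH₁ _ _ ih₂ =>
    rw [mul_assoc _ H₂ K]
    exact Pol.marked _ _ a hH₁ ih₂

end PolynomialClosure

section Approximation

variable {A M : Type*} [Monoid M] [Preorder M] {C : Set (Language A)} {α : FreeMonoid A →* M}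

theorem exists_mem_forall_le_mul_mul [Finite M] (hC : IsRegularQuotientingLattice C) {e : M}
    (he : ∀ t, IsPair C α e t → e ≤ e * t * e) :
    ∃ H ∈ C, fiber α e ≤ H ∧ ∀ v : FreeMonoid A, v.toList ∈ H → e ≤ e * α v * e := by
  have hsep (t : M) : ∃ H ∈ C, fiber α e ≤ H ∧
      ∀ v : FreeMonoid A, v.toList ∈ H → α v = t → e ≤ e * t * e := by
    by_cases hle : e ≤ e * t * e
    · exact ⟨⊤, hC.univ_mem, le_top, fun _ _ _ => hle⟩
    · obtain ⟨H, hH, hsub, hdisj⟩ := not_not.1 (mt (he t) hle)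
      refine ⟨H, hH, hsub, fun v hv hvt => ?_⟩
      have hbot : v.toList ∈ (⊥ : Language A) := hdisj ▸ ⟨hvt, hv⟩
      exact absurd hbot (Language.notMem_zero _)
  choose H hH hsub hle using hsep
  exact ⟨⨅ t, H t, hC.infClosed.iInf_mem hC.univ_mem hH, le_iInf hsub,
    fun v hv => hle (α v) v (iInf_le H (α v) hv) rfl⟩

theorem exists_mem_forall_one_le [Finite M] (hC : IsRegularQuotientingLattice C)
    (h : ∀ t, IsPair C α 1 t → 1 ≤ t) :
    ∃ H ∈ C, [] ∈ H ∧ ∀ v : FreeMonoid A, v.toList ∈ H → 1 ≤ α v := by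
  obtain ⟨H, hH, hsub, hle⟩ := exists_mem_forall_le_mul_mul (α := α) (e := 1) hC fun t ht => by
    simpa only [one_mul, mul_one] using h t ht
  exact ⟨H, hH, hsub (map_one α), by simpa only [one_mul, mul_one] using hle⟩

/-- For each `s`, the words of `U` with image `s` are covered by a language of `Pol C` in which
every word has an image at least `s`. For `U = A*`, this puts the preimage of each upper set of `M`
into `Pol C`. -/
def PolApproximable (C : Set (Language A)) (α : FreeMonoid A →* M) (U : Set (FreeMonoid A)) :
    Prop :=
  ∀ s, ∃ K ∈ Pol C, (∀ w ∈ U, α w = s → w.toList ∈ K) ∧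
    ∀ v : FreeMonoid A, v.toList ∈ K → s ≤ α v

theorem PolApproximable.mem_pol [Finite M] (hC : IsRegularQuotientingLattice C)
    (h : PolApproximable C α Set.univ) {L : Language A}
    (hL : ∀ u v : FreeMonoid A, α u ≤ α v → u.toList ∈ L → v.toList ∈ L) : L ∈ Pol C := by
  choose K hK hcover hle using h
  have hLK : L = ⨆ s : α '' {u | u.toList ∈ L}, K s := by
    ext w
    rw [Language.mem_iSup]
    constructor
    · exact fun hw => ⟨⟨_, .ofList w, hw, rfl⟩, hcover _ (.ofList w) trivial rfl⟩
    · rintro ⟨⟨_, u, hu, rfl⟩, hw⟩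
      exact hL u (.ofList w) (hle _ _ hw) hu
  rw [hLK]
  exact Pol.iSup_mem hC fun s => hK s

variable {U V : Set (FreeMonoid A)}

theorem PolApproximable.mono (hV : PolApproximable C α V) (hUV : U ⊆ V) :
    PolApproximable C α U := fun s => by
  obtain ⟨K, hK, hcover, hle⟩ := hV s
  exact ⟨K, hK, fun w hw => hcover w (hUV hw), hle⟩

theorem PolApproximable.of_forall_eq (hC : IsRegularQuotientingLattice C) {e : M}
    {K : Language A} (hK : K ∈ Pol C) (hU : ∀ w ∈ U, α w = e ∧ w.toList ∈ K)
    (hle : ∀ v : FreeMonoid A, v.toList ∈ K → e ≤ α v) : PolApproximable C α U := fun s => by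
  obtain rfl | hs := eq_or_ne e s
  · exact ⟨K, hK, fun w hw _ => (hU w hw).2, hle⟩
  · exact ⟨⊥, .base _ hC.empty_mem, fun w hw hws => absurd ((hU w hw).1.symm.trans hws) hs,
      fun v hv => absurd hv (Language.notMem_zero _)⟩

theorem PolApproximable.iUnion (hC : IsRegularQuotientingLattice C) {ι : Type*} [Finite ι]
    {U : ι → Set (FreeMonoid A)} (hU : ∀ i, PolApproximable C α (U i)) :
    PolApproximable C α (⋃ i, U i) := fun s => by
  choose K hK hcover hle using fun i => hU i s
  refine ⟨⨆ i, K i, Pol.iSup_mem hC hK, fun w hw hws => ?_, fun v hv => ?_⟩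
  · obtain ⟨i, hi⟩ := Set.mem_iUnion.1 hw
    exact Language.mem_iSup.2 ⟨i, hcover i w hi hws⟩
  · obtain ⟨i, hi⟩ := Language.mem_iSup.1 hv
    exact hle i v hi

theorem PolApproximable.union (hU : PolApproximable C α U) (hV : PolApproximable C α V) :
    PolApproximable C α (U ∪ V) := fun s => by
  obtain ⟨K, hK, hcoverU, hleK⟩ := hU s
  obtain ⟨H, hH, hcoverV, hleH⟩ := hV s
  exact ⟨K ⊔ H, .union _ _ hK hH, fun w hw hws => hw.imp (hcoverU w · hws) (hcoverV w · hws),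
    fun v hv => hv.elim (hleK v) (hleH v)⟩

variable [MulLeftMono M] [MulRightMono M]

theorem PolApproximable.mul [Finite A] [Finite M] (hC : IsRegularQuotientingLattice C)
    (hU : PolApproximable C α U) (hV : PolApproximable C α V) :
    PolApproximable C α (U * V) := fun s => by
  choose K hK hcoverU hleK using hU
  choose H hH hcoverV hleH using hV
  refine ⟨⨆ x : {x : M × M // x.1 * x.2 = s}, K x.1.1 * H x.1.2,
    Pol.iSup_mem hC fun x => Pol.mul hC (hK _) (hH _), ?_, fun w hw => ?_⟩
  · rintro _ ⟨u, hu, v, hv, rfl⟩ huv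
    exact Language.mem_iSup.2 ⟨⟨(α u, α v), (map_mul α u v).symm.trans huv⟩,
      Language.append_mem_mul (hcoverU _ u hu rfl) (hcoverV _ v hv rfl)⟩
  · obtain ⟨⟨x, rfl⟩, u, hu, v, hv, rfl⟩ := Language.mem_iSup.1 hw
    exact (mul_le_mul' (hleK _ _ hu) (hleH _ _ hv)).trans_eq (map_mul α _ _).symm

theorem PolApproximable.range_of [Finite A] [Finite M] (hC : IsRegularQuotientingLattice C)
    (hpair : ∀ t, IsPair C α 1 t → 1 ≤ t) :
    PolApproximable C α (Set.range FreeMonoid.of) := by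
  obtain ⟨H, hH, hnil, hle⟩ := exists_mem_forall_one_le hC hpair
  have hunion := PolApproximable.iUnion (α := α) (U := fun a : A => {FreeMonoid.of a}) hC
    fun a => .of_forall_eq (e := α (.of a)) hC (.marked H H a (.base H hH) (.base H hH)) ?_ ?_
  · simpa using hunion
  · rintro _ rfl
    exact ⟨rfl, mem_marked_iff.2 ⟨1, 1, by simp, hnil, hnil⟩⟩
  · intro v hv
    obtain ⟨x, y, rfl, hx, hy⟩ := mem_marked_iff.1 hv
    calc α (.of a) = 1 * α (.of a) * 1 := by simp
      _ ≤ α x * α (.of a) * α y := by gcongr; exacts [hle x hx, hle y hy]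
      _ = α (x * .of a * y) := by simp

theorem PolApproximable.ramsey [Finite A] [Finite M] (hC : IsRegularQuotientingLattice C)
    {e : M} (he : IsIdempotentElem e) (hpair : ∀ t, IsPair C α e t → e ≤ e * t * e)
    (hU : PolApproximable C α U) :
    PolApproximable C α ((U ∩ α ⁻¹' {e}) * α ⁻¹' {e} * (U ∩ α ⁻¹' {e})) := by
  obtain ⟨H, hH, hsub, hleH⟩ := exists_mem_forall_le_mul_mul hC hpair
  obtain ⟨K, hK, hcover, hleK⟩ := hU e
  refine .of_forall_eq (e := e) hC (Pol.mul hC (Pol.mul hC hK (.base H hH)) hK) ?_ ?_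
  · rintro _ ⟨_, ⟨x, ⟨hxU, hx⟩, w, hw, rfl⟩, y, ⟨hyU, hy⟩, rfl⟩
    rw [Set.mem_preimage, Set.mem_singleton_iff] at hx hw hy
    exact ⟨by simp only [map_mul, hx, hw, hy, he.eq], Language.append_mem_mul
      (Language.append_mem_mul (hcover x hxU hx) (hsub hw)) (hcover y hyU hy)⟩
  · rintro _ ⟨_, ⟨x, hx, v, hv, rfl⟩, y, hy, rfl⟩
    calc e ≤ e * α (.ofList v) * e := hleH _ hv
      _ ≤ α (.ofList x) * α (.ofList v) * α (.ofList y) := by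
        gcongr; exacts [hleK _ hx, hleK _ hy]
      _ = α (.ofList (x ++ v ++ y)) := by rw [← map_mul, ← map_mul]; rfl

theorem PolApproximable.of_boundedForest [Finite A] [Finite M]
    (hC : IsRegularQuotientingLattice C)
    (hpair : ∀ e t, IsIdempotentElem e → IsPair C α e t → e ≤ e * t * e)
    (hU : BoundedForest α (Set.range FreeMonoid.of) U) : PolApproximable C α U := by
  have hpair_one (t : M) (ht : IsPair C α 1 t) : 1 ≤ t := by
    simpa only [one_mul, mul_one] using hpair 1 t .one ht
  induction hU with
  | generators => exact .range_of hC hpair_one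
  | one =>
    obtain ⟨H, hH, hnil, hle⟩ := exists_mem_forall_one_le hC hpair_one
    refine .of_forall_eq hC (.base H hH) ?_ hle
    rintro _ rfl
    exact ⟨map_one α, hnil⟩
  | subset hUV _ ih => exact ih.mono hUV
  | union _ _ ihU ihV => exact ihU.union ihV
  | mul _ _ ihU ihV => exact ihU.mul hC ihV
  | ramsey he _ ih => exact ih.ramsey hC he (hpair _ · he)

end Approximation

section SyntacticOrder

variable {A : Type*} (L : Language A)

instance : MulLeftMono (SyntacticMonoid L) where
  elim s t t' h x y hx := by
    simpa only [mul_assoc] using h (x * s) y (by simpa only [mul_assoc] using hx)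

instance : MulRightMono (SyntacticMonoid L) where
  elim s t t' h x y hx := by
    simpa only [Function.swap, mul_assoc] using
      h x (s * y) (by simpa only [Function.swap, mul_assoc] using hx)

variable {L} in
theorem mem_of_syntacticMorphism_le {u v : FreeMonoid A}
    (h : syntacticMorphism L u ≤ syntacticMorphism L v) (hu : u.toList ∈ L) : v.toList ∈ L := by
  rw [← mem_syntacticImage_iff] at hu ⊢
  simpa using h 1 1 (by simpa using hu)

end SyntacticOrder

section Pumping

variable {A : Type*} {C D : Set (Language A)} {H K : Language A}

/-- The canonical preorder on words associated with the set `D` of languages. -/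
def CanonicalLE (D : Set (Language A)) (u v : FreeMonoid A) : Prop :=
  ∀ K ∈ D, u.toList ∈ K → v.toList ∈ K

theorem IsPair.exists_canonicalLE (hC : IsRegularQuotientingLattice C) {M : Type*} [Monoid M]
    {α : FreeMonoid A →* M} {s t : M} (h : IsPair C α s t) (hD : D.Finite) (hDC : D ⊆ C) :
    ∃ u v, α u = s ∧ α v = t ∧ CanonicalLE D u v := by
  by_contra! hno
  let upper (u : List A) : Language A := sInf {K ∈ D | u ∈ K}
  have hupper (u : List A) : upper u ∈ C :=
    hC.infClosed.sInf_mem (hD.sep _) hC.univ_mem fun K hK => hDC hK.1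
  have hfin : (upper '' fiber α s).Finite :=
    (hD.finite_subsets.image sInf).subset <| by
      rintro _ ⟨u, -, rfl⟩
      exact ⟨_, Set.sep_subset _ _, rfl⟩
  refine h ⟨sSup (upper '' fiber α s), hC.supClosed.sSup_mem hfin hC.empty_mem ?_, ?_, ?_⟩
  · rintro _ ⟨u, -, rfl⟩
    exact hupper u
  · exact fun u hu => ⟨upper u, ⟨u, hu, rfl⟩, fun K hK => hK.2⟩
  · refine eq_bot_iff.2 fun v ⟨hv, _, ⟨u, hu, rfl⟩, huv⟩ => ?_
    exact hno (.ofList u) (.ofList v) hu hv fun K hK huK => huv K ⟨hK, huK⟩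

theorem mul_of_mul_eq_mul_cases {h k x y : FreeMonoid A} {a : A}
    (e : h * FreeMonoid.of a * k = x * y) :
    (∃ z, x = h * FreeMonoid.of a * z ∧ k = z * y) ∨
      ∃ z, y = z * FreeMonoid.of a * k ∧ h = x * z := by
  have e' : h.toList ++ a :: k.toList = x.toList ++ y.toList := by
    simpa using congrArg FreeMonoid.toList e
  rcases List.append_eq_append_iff.1 e' with ⟨z, hx, hz⟩ | ⟨z, hh, hy⟩
  · cases z with
    | nil => exact Or.inr ⟨1, hz.symm, by simpa using hx.symm⟩
    | cons b z =>
      obtain rfl := (List.cons.inj hz).1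
      exact Or.inl ⟨.ofList z, by rw [mul_assoc]; exact hx, (List.cons.inj hz).2⟩
  · exact Or.inr ⟨.ofList z, by rw [mul_assoc]; exact hy, hh⟩

theorem mul_of_mul_eq_mul_pow_mul_cases {h k u : FreeMonoid A} {a : A} (y : FreeMonoid A) {n : ℕ}
    {x : FreeMonoid A} (e : h * FreeMonoid.of a * k = x * u ^ n * y) :
    (∃ z, x = h * FreeMonoid.of a * z ∧ k = z * u ^ n * y) ∨
    (∃ z, y = z * FreeMonoid.of a * k ∧ h = x * u ^ n * z) ∨
    ∃ i j u₁ u₂, i + j + 1 = n ∧ u = u₁ * FreeMonoid.of a * u₂ ∧ h = x * u ^ i * u₁ ∧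
      k = u₂ * u ^ j * y := by
  induction n generalizing x with
  | zero =>
    simp only [pow_zero, mul_one] at e ⊢
    exact (mul_of_mul_eq_mul_cases e).imp_right Or.inl
  | succ n ih =>
    simp only [pow_succ', ← mul_assoc] at e ⊢
    rcases ih e with ⟨z, hx, hk⟩ | ⟨z, hy, hh⟩ | ⟨i, j, u₁, u₂, rfl, hu, hh, hk⟩
    · rcases mul_of_mul_eq_mul_cases hx.symm with ⟨z', hx', rfl⟩ | ⟨z', hu, hh⟩
      · exact Or.inl ⟨z', hx', hk⟩
      · exact Or.inr (Or.inr ⟨0, n, z', z, by omega, hu, by simpa using hh, hk⟩)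
    · exact Or.inr (Or.inl ⟨z, hy, hh⟩)
    · exact Or.inr (Or.inr ⟨i + 1, j, u₁, u₂, by omega, hu,
        by rw [hh, pow_succ']; simp only [mul_assoc], hk⟩)

/-- The pumping property of the languages in `Pol C`, for a finite `D ⊆ C`: in a word of `H`, a
large power of `u` may be replaced by a word `u ^ a * v * u ^ b` with `u ≤ v` in the canonical
preorder of `D`, provided that `a` and `b` are large and the length of the power is preserved
modulo `q` when the factor `v` is counted as one `u`. -/
def Pumps (D : Set (Language A)) (q n : ℕ) (H : Language A) : Prop :=
  ∀ ⦃u v⦄, CanonicalLE D u v → ∀ ⦃x y : FreeMonoid A⦄ ⦃m a b : ℕ⦄,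
    n ≤ m → m ≤ a → m ≤ b → a + b ≡ m [MOD q] →
      (x * u ^ (m + 1) * y).toList ∈ H → (x * u ^ a * v * u ^ b * y).toList ∈ H

theorem Pumps.mono {D' : Set (Language A)} {q q' n n' : ℕ} (h : Pumps D q n H) (hD : D ⊆ D')
    (hq : q ∣ q') (hn : n ≤ n') : Pumps D' q' n' H :=
  fun _ _ huv _ _ _ _ _ hm ha hb hab =>
    h (fun K hK => huv K (hD hK)) (hn.trans hm) ha hb (hab.of_dvd hq)

theorem Pumps.sup {q n : ℕ} (hH : Pumps D q n H) (hK : Pumps D q n K) : Pumps D q n (H ⊔ K) :=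
  fun _ _ huv _ _ _ _ _ hm ha hb hab =>
    Or.imp (hH huv hm ha hb hab) (hK huv hm ha hb hab)

theorem Pumps.marked {q n₁ n₂ : ℕ} (c : A) (hH : Pumps D q n₁ H) (hK : Pumps D q n₂ K) :
    Pumps D q (n₁ + n₂ + 1) (H * {[c]} * K) := by
  intro u v huv x y m a b hm ha hb hab hmem
  obtain ⟨h, k, e, hh, hk⟩ := mem_marked_iff.1 hmem
  rw [mem_marked_iff]
  rcases mul_of_mul_eq_mul_pow_mul_cases y e.symm with
    ⟨z, rfl, rfl⟩ | ⟨z, rfl, rfl⟩ | ⟨i, j, u₁, u₂, hij, hu, rfl, rfl⟩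
  · exact ⟨h, z * u ^ a * v * u ^ b * y, by simp only [mul_assoc], hh,
      hK huv (by omega) ha hb hab hk⟩
  · exact ⟨x * u ^ a * v * u ^ b * z, k, by simp only [mul_assoc],
      hH huv (by omega) ha hb hab hh, hk⟩
  obtain rfl : i + j = m := by omega
  -- The marked letter lies in the copy `u = u₁ c u₂` preceded by `i` copies and followed by `j`:
  -- pump on the side where many copies remain.
  obtain hi | hj : n₁ + 1 ≤ i ∨ n₂ + 1 ≤ j := by omega
  · obtain ⟨i, rfl⟩ := Nat.exists_eq_add_of_le' (Nat.one_le_of_lt hi)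
    obtain ⟨b, rfl⟩ := Nat.exists_eq_add_of_le' (show 1 + j ≤ b by omega)
    have hab' : a + b ≡ i [MOD q] := Nat.ModEq.add_right_cancel' (1 + j) (by
      simpa only [add_assoc] using hab)
    refine ⟨x * u ^ a * v * u ^ b * u₁, u₂ * u ^ j * y, ?_, ?_, hk⟩
    · simp only [pow_add, pow_one, mul_assoc]
      nth_rewrite 3 [hu]
      simp only [mul_assoc]
    · simpa only [mul_assoc] using hH huv (by omega) (by omega) (by omega) hab'
        (y := u₁) hh
  · obtain ⟨j, rfl⟩ := Nat.exists_eq_add_of_le' (Nat.one_le_of_lt hj)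
    obtain ⟨a, rfl⟩ := Nat.exists_eq_add_of_le (show i + 1 ≤ a by omega)
    have hab' : a + b ≡ j [MOD q] := Nat.ModEq.add_left_cancel' (i + 1) (by
      convert hab using 1 <;> omega)
    refine ⟨x * u ^ i * u₁, u₂ * u ^ a * v * u ^ b * y, ?_, hh, ?_⟩
    · simp only [pow_add, pow_one, mul_assoc]
      nth_rewrite 2 [hu]
      simp only [mul_assoc]
    · exact hK huv (by omega) (by omega) (by omega) hab' hk

/-- The two-sided quotients `x⁻¹Ky⁻¹` of `K`: the languages on which the pumping property of a
regular `K` depends. -/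
def quotients (K : Language A) : Set (Language A) :=
  Set.range fun z : List A × List A => rightQuotient (K.leftQuotient z.1) z.2

theorem finite_quotients (hK : K.IsRegular) : (quotients K).Finite := by
  have := finite_syntacticMonoid hK
  refine (Set.finite_range fun z : SyntacticMonoid K × SyntacticMonoid K =>
    ({w | z.1 * syntacticMorphism K (.ofList w) * z.2 ∈ syntacticImage K} :
      Language A)).subset ?_
  rintro _ ⟨⟨x, y⟩, rfl⟩
  refine ⟨(syntacticMorphism K (.ofList x), syntacticMorphism K (.ofList y)), ?_⟩
  ext w
  change _ * _ * _ ∈ syntacticImage K ↔ x ++ (w ++ y) ∈ K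
  rw [← map_mul, ← map_mul, mem_syntacticImage_iff]
  simp

theorem CanonicalLE.mul_mul_mem {u v x y : FreeMonoid A} (h : CanonicalLE (quotients K) u v)
    (hu : (x * u * y).toList ∈ K) : (x * v * y).toList ∈ K := by
  have hv : x.toList ++ (v.toList ++ y.toList) ∈ K :=
    h _ ⟨(x.toList, y.toList), rfl⟩ (by rwa [mul_assoc] at hu)
  rwa [mul_assoc]

theorem pumps_of_isRegular (hK : K.IsRegular) :
    Pumps (quotients K) (omega (SyntacticMonoid K)) (omega (SyntacticMonoid K)) K := by
  have := finite_syntacticMonoid hK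
  intro u v huv x y m a b hm _ hb hab hmem
  have hpow : syntacticMorphism K u ^ (a + 1 + b) = syntacticMorphism K u ^ (m + 1) :=
    pow_eq_pow_of_modEq_omega _ (by omega) (by omega) (by
      simpa only [add_right_comm a 1 b] using hab.add_right 1)
  have hu : (x * u ^ a * u * (u ^ b * y)).toList ∈ K := by
    rw [← mem_syntacticImage_iff] at hmem ⊢
    simp only [map_mul, map_pow] at hmem ⊢
    rw [← hpow] at hmem
    simpa only [pow_add, pow_one, mul_assoc] using hmem
  simpa only [mul_assoc] using huv.mul_mul_mem hu

theorem Pol.exists_pumps (hC : IsRegularQuotientingLattice C) (hH : H ∈ Pol C) :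
    ∃ D ⊆ C, D.Finite ∧ ∃ q > 0, ∃ n, Pumps D q n H := by
  induction hH with
  | base K hK =>
    have hreg := hC.isRegular K hK
    have := finite_syntacticMonoid hreg
    refine ⟨quotients K, ?_, finite_quotients hreg, _, (omega_spec _).1, _,
      pumps_of_isRegular hreg⟩
    rintro _ ⟨z, rfl⟩
    exact hC.rightQuotient_mem _ (hC.leftQuotient_mem _ hK _) _
  | union H K _ _ ihH ihK =>
    obtain ⟨D, hDC, hD, q, hq, n, h⟩ := ihH
    obtain ⟨D', hDC', hD', q', hq', n', h'⟩ := ihK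
    exact ⟨D ∪ D', Set.union_subset hDC hDC', hD.union hD', q * q', Nat.mul_pos hq hq', n + n',
      (h.mono Set.subset_union_left (dvd_mul_right _ _) (Nat.le_add_right _ _)).sup
        (h'.mono Set.subset_union_right (dvd_mul_left _ _) (Nat.le_add_left _ _))⟩
  | marked H K a _ _ ihH ihK =>
    obtain ⟨D, hDC, hD, q, hq, n, h⟩ := ihH
    obtain ⟨D', hDC', hD', q', hq', n', h'⟩ := ihK
    exact ⟨D ∪ D', Set.union_subset hDC hDC', hD.union hD', q * q', Nat.mul_pos hq hq', _,
      (h.mono Set.subset_union_left (dvd_mul_right _ _) le_rfl).marked a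
        (h'.mono Set.subset_union_right (dvd_mul_left _ _) le_rfl)⟩

theorem Pol.pow_omega_succ_le (hC : IsRegularQuotientingLattice C) {L : Language A}
    [Finite (SyntacticMonoid L)] (hL : L ∈ Pol C) {s t : SyntacticMonoid L}
    (hst : IsPair C (syntacticMorphism L) s t) :
    s ^ (omega (SyntacticMonoid L) + 1) ≤
      s ^ omega (SyntacticMonoid L) * t * s ^ omega (SyntacticMonoid L) := by
  obtain ⟨D, hDC, hD, q, hq, n, hpumps⟩ := Pol.exists_pumps hC hL
  obtain ⟨u, v, rfl, rfl, huv⟩ := hst.exists_canonicalLE hC hD hDC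
  intro x y hxy
  obtain ⟨x, rfl⟩ := syntacticMorphism_surjective L x
  obtain ⟨y, rfl⟩ := syntacticMorphism_surjective L y
  have hω := (omega_spec (SyntacticMonoid L)).1
  set m := omega (SyntacticMonoid L) * (q * (n + 1)) with hm
  have hpow : syntacticMorphism L u ^ m = syntacticMorphism L u ^ omega (SyntacticMonoid L) :=
    pow_omega_mul_eq_pow_omega _ (by positivity)
  have hnm : n ≤ m := by
    calc n ≤ n + 1 := n.le_succ
      _ ≤ q * (n + 1) := Nat.le_mul_of_pos_left _ hq
      _ ≤ m := Nat.le_mul_of_pos_left _ hω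
  have hqm : m ≡ 0 [MOD q] := (Nat.modEq_zero_iff_dvd).2 ⟨omega (SyntacticMonoid L) * (n + 1), by
    rw [hm]; ring⟩
  have hmem : (x * u ^ (m + 1) * y).toList ∈ L := by
    rw [← mem_syntacticImage_iff]
    simpa only [map_mul, map_pow, pow_succ, hpow] using hxy
  have hpumped := hpumps huv hnm le_rfl le_rfl (by simpa using hqm.add_left m) hmem
  rw [← mem_syntacticImage_iff] at hpumped
  simpa only [map_mul, map_pow, hpow, mul_assoc] using hpumped

end Pumping

end PolClosure

theorem mainTheorem1 {A : Type*} [Finite A] (C : Set (Language A))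
    (hC : PolClosure.IsRegularQuotientingLattice C) (L : Language A) (hL : L.IsRegular) :
    List.TFAE [
      L ∈ PolClosure.Pol C,
      ∀ s t : PolClosure.SyntacticMonoid L,
        PolClosure.IsPair C (PolClosure.syntacticMorphism L) s t →
          s ^ (PolClosure.omega (PolClosure.SyntacticMonoid L) + 1) ≤
            s ^ PolClosure.omega (PolClosure.SyntacticMonoid L) * t *
              s ^ PolClosure.omega (PolClosure.SyntacticMonoid L),
      ∀ e t : PolClosure.SyntacticMonoid L, IsIdempotentElem e →
        PolClosure.IsPair C (PolClosure.syntacticMorphism L) e t → e ≤ e * t * e] := by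
  have := PolClosure.finite_syntacticMonoid hL
  tfae_have 1 → 2 := fun hP s t hst => PolClosure.Pol.pow_omega_succ_le hC hP hst
  tfae_have 2 → 3 := by
    intro h e t he het
    have hω := (PolClosure.omega_spec (PolClosure.SyntacticMonoid L)).1
    have hle := h e t het
    rwa [he.pow_succ_eq, he.pow_eq hω.ne'] at hle
  tfae_have 3 → 1 := fun h =>
    (PolClosure.PolApproximable.of_boundedForest hC h
      (.univ FreeMonoid.closure_range_of)).mem_pol hC
        fun _ _ => PolClosure.mem_of_syntacticMorphism_le
  tfae_finish
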